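/- Let $a\ge b>0$, $0<\mu<1$ and $r>0$. Consider the two concentric, homothetic ellipses $$\mathcal E_H:\ \frac{x^2}{a^2}+\frac{y^2}{b^2}=1 ,\qquad \mathcal E_h:\ \frac{x^2}{(\mu a)^2}+\frac{y^2}{(\mu b)^2}=1 ,$$ so that $a,b$ are the semi-axes of the outer ellipse $\mathcal E_H$, and let $f_1=(-c,0)$, $f_2=(c,0)$ with $c=\mu\sqrt{a^2-b^2}$ be the foci of the inner ellipse $\mathcal E_h$. The homothetic Poncelet family is the family of all convex $N$-gons $P=P_1\dots P_N$ whose vertices lie on $\mathcal E_H$ and whose sidelines $P_iP_{i+1}$ (indices modulo $N$) are tangent to $\mathcal E_h$. (Such polygons exist only if $\mu=\cos(\pi/N)$.) For $j=1,2$, let $Q_j$ be the polar image of $P$ with respect to the circle of radius $r$ centered at $f_j$, i.e. the $N$-gon whose vertices are the poles of the consecutive sidelines of $P$ with respect to that circle. Let $N=3$ or $N=5$. Then, for every member $P$ of the family, $Q_1$ and $Q_2$ are well defined and are harmonic polygons, that is, convex polygons inscribed in a circle which contain an interior point whose distance to each sideline is a fixed proportion of the corresponding sidelength. Moreover, if $A_1,A_2$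 are the areas of $Q_1,Q_2$, then $\frac1{A_1}+\frac1{A_2}$ is the same for all members $P$ of the family and is given by $$N=3:\quad \frac1{A_1}+\frac1{A_2}=\frac1{r^4}\,\frac{\sqrt3}{18}\,\frac ba\,(a^2+3b^2),$$ $$N=5:\quad \frac1{A_1}+\frac1{A_2}=\frac1{r^4}\,\frac{b}{40\sin(2\pi/5)\,a}\cdot\frac{(a^4+10b^2a^2+5b^4)\left(\sqrt5\,(a^2+3b^2)+5a^2+7b^2\right)}{5a^4+10b^2a^2+b^4}.$$ In particular, for polar images with respect to unit circles ($r=1$) the factor $1/r^4$ is absent. -/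

import Mathlib

noncomputable section

/-- The Euclidean plane. -/
abbrev Plane := EuclideanSpace ℝ (Fin 2)

/-- The ellipse centred at the origin with semi-axis `p` along the first coordinate axis and
semi-axis `q` along the second one. -/
def ellipse (p q : ℝ) : Set Plane := {X | X 0 ^ 2 / p ^ 2 + X 1 ^ 2 / q ^ 2 = 1}

/-- The focus of `ellipse p q` (where `q ≤ p`) with non-positive first coordinate. -/
def leftFocus (p q : ℝ) : Plane := !₂[-Real.sqrt (p ^ 2 - q ^ 2), 0]

/-- The focus of `ellipse p q` (where `q ≤ p`) with non-negative first coordinate. -/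
def rightFocus (p q : ℝ) : Plane := !₂[Real.sqrt (p ^ 2 - q ^ 2), 0]

/-- The determinant of the vectors `B - A` and `X - A`; its sign tells on which side of the
line `AB` the point `X` lies. -/
def orient (A B X : Plane) : ℝ :=
  (B 0 - A 0) * (X 1 - A 1) - (B 1 - A 1) * (X 0 - A 0)

/-- `X` and `Y` lie strictly on the same side of the line `AB`. -/
def StrictlySameSide (A B X Y : Plane) : Prop := 0 < orient A B X * orient A B Y

/-- The `i`-th sideline of a polygon; the indices are cyclic. -/
def sideline {N : ℕ} [NeZero N] (P : Polygon Plane N) (i : Fin N) : AffineSubspace ℝ Plane :=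
  line[ℝ, P i, P (i + 1)]

/-- The polygon is (strictly) convex: for every side, all vertices that are not endpoints of
that side lie strictly on the same side of its sideline. -/
def IsConvexPolygon {N : ℕ} [NeZero N] (P : Polygon Plane N) : Prop :=
  ∀ i j k : Fin N, j ≠ i → j ≠ i + 1 → k ≠ i → k ≠ i + 1 →
    StrictlySameSide (P i) (P (i + 1)) (P j) (P k)

/-- The area of a convex polygon, by the shoelace formula. -/
def polygonArea {N : ℕ} [NeZero N] (P : Polygon Plane N) : ℝ :=
  |∑ i : Fin N, (P i 0 * P (i + 1) 1 - P (i + 1) 0 * P i 1)| / 2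

/-- A line is tangent to an ellipse if it meets the ellipse in exactly one point. -/
def IsTangentTo (l : AffineSubspace ℝ Plane) (E : Set Plane) : Prop :=
  ∃! X : Plane, X ∈ l ∧ X ∈ E

/-- `P` is a member of the Poncelet family of convex `N`-gons interscribed between the outer
ellipse `Eout` and the inner ellipse `Ein`: its vertices lie on `Eout` and its sidelines are
tangent to `Ein`. -/
structure IsPonceletMember {N : ℕ} [NeZero N] (Eout Ein : Set Plane)
    (P : Polygon Plane N) : Prop where
  convex : IsConvexPolygon P
  inscribed : ∀ i, P i ∈ Eout
  circumscribed : ∀ i, IsTangentTo (sideline P i) Ein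

/-- The polar of the point `Y` with respect to the circle with centre `F` and radius `r`. -/
def polarLine (F : Plane) (r : ℝ) (Y : Plane) : Set Plane :=
  {X | inner ℝ (X - F) (Y - F) = r ^ 2}

/-- `Q` is the polar image of the polygon `P` with respect to the circle with centre `F` and
radius `r`: the `i`-th vertex of `Q` is the pole of the `i`-th sideline of `P`. -/
def IsPolarImage {N : ℕ} [NeZero N] (F : Plane) (r : ℝ) (P Q : Polygon Plane N) : Prop :=
  ∀ i, polarLine F r (Q i) = (sideline P i : Set Plane)

/-- A harmonic polygon: a convex polygon inscribed in a circle, with an interior point `K`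
(the symmedian point) whose distance to each sideline is a fixed proportion of the
corresponding sidelength. -/
structure IsHarmonicPolygon {N : ℕ} [NeZero N] (Q : Polygon Plane N) : Prop where
  convex : IsConvexPolygon Q
  cyclic : EuclideanGeometry.Cospherical (Set.range Q.vertices)
  symmedian : ∃ (K : Plane) (κ : ℝ),
    (∀ i j : Fin N, j ≠ i → j ≠ i + 1 → StrictlySameSide (Q i) (Q (i + 1)) K (Q j)) ∧
    ∀ i : Fin N, Metric.infDist K (sideline Q i : Set Plane) = κ * dist (Q i) (Q (i + 1))

end

/-! Scaling the axes by `1 / a` and `1 / b` turns the ellipses into concentric circles of radii 1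
and `μ`. Tangency makes consecutive vertices subtend a constant angle and convexity fixes its sense,
so each vertex follows from the previous one by the same rotation (`IsPonceletMember.exists_orbit`).
Rotating by half that angle gives the tangency directions.

The polar dual of a conic about a focus is a circle. In coordinates it is a projective image of the
unit circle with weights `W i = a - g * x i`, `g = ±√(a² - b²)`. Distances from the focus to the
sidelines and squared sidelengths both scale like `1 / (W i * W (i + 1))`, which makes the focus the
symmedian point (`isHarmonicPolygon_focalPolar`). The area is a constant times `∑ 1 / (W i * W (i +
1))`.

Closure and convexity determine the cosine of the rotation, hence `μ`. Over the common denominator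
`∏ W i` the sum has a constant numerator. With `x i = cos (φ + 2πi/N)`, that product is a Chebyshev
polynomial in `a / g`, homogenized, plus a term in `g ^ N` that alone depends on `φ`. As `N` is odd,
the two foci contribute this term with opposite signs, and it cancels. -/

/-! ### Coordinate geometry of lines and poles. -/

theorem Plane.ext' {X Y : Plane} (h₀ : X 0 = Y 0) (h₁ : X 1 = Y 1) : X = Y := by
  ext i
  fin_cases i
  · exact h₀
  · exact h₁

theorem dist_sq_plane (X Y : Plane) : dist X Y ^ 2 = (X 0 - Y 0) ^ 2 + (X 1 - Y 1) ^ 2 := by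
  rw [EuclideanSpace.dist_eq, Real.sq_sqrt (by positivity), Fin.sum_univ_two, Real.dist_eq,
    Real.dist_eq, sq_abs, sq_abs]

theorem inner_plane (X Y : Plane) : inner ℝ X Y = X 0 * Y 0 + X 1 * Y 1 := by
  simp [PiLp.inner_apply, Fin.sum_univ_two, mul_comm]

theorem mem_line_iff_exists {A B X : Plane} :
    X ∈ line[ℝ, A, B] ↔
      ∃ t : ℝ, X 0 = A 0 + t * (B 0 - A 0) ∧ X 1 = A 1 + t * (B 1 - A 1) := by
  rw [mem_affineSpan_pair_iff_exists_lineMap_eq]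
  refine exists_congr fun t => ⟨?_, fun ⟨h₀, h₁⟩ => Plane.ext' ?_ ?_⟩
  · rintro rfl
    simp [AffineMap.lineMap_apply, add_comm]
  · simp [AffineMap.lineMap_apply, h₀, add_comm]
  · simp [AffineMap.lineMap_apply, h₁, add_comm]

theorem orient_self_left (A B : Plane) : orient A B A = 0 := by simp [orient]

theorem sub_sq_add_sub_sq_pos {A B : Plane} (h : A ≠ B) :
    0 < (B 0 - A 0) ^ 2 + (B 1 - A 1) ^ 2 := by
  rw [← dist_sq_plane]
  exact pow_pos (dist_pos.2 h.symm) 2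

theorem mem_line_iff_orient {A B X : Plane} (h : A ≠ B) :
    X ∈ line[ℝ, A, B] ↔ orient A B X = 0 := by
  rw [mem_line_iff_exists]
  constructor
  · rintro ⟨t, h₀, h₁⟩
    rw [orient, h₀, h₁]
    ring
  · intro hX
    have hD := sub_sq_add_sub_sq_pos h
    rw [orient] at hX
    refine ⟨((B 0 - A 0) * (X 0 - A 0) + (B 1 - A 1) * (X 1 - A 1)) /
      ((B 0 - A 0) ^ 2 + (B 1 - A 1) ^ 2), ?_, ?_⟩
    · field_simp
      linear_combination -(B 1 - A 1) * hX
    · field_simp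
      linear_combination (B 0 - A 0) * hX

theorem infDist_line {A B : Plane} (h : A ≠ B) (K : Plane) :
    Metric.infDist K (line[ℝ, A, B] : Set Plane) = |orient A B K| / dist A B := by
  have hD := sub_sq_add_sub_sq_pos h
  have hd : 0 < dist A B := dist_pos.2 h
  have hsq : dist A B ^ 2 = (B 0 - A 0) ^ 2 + (B 1 - A 1) ^ 2 := by
    rw [dist_comm, dist_sq_plane]
  apply le_antisymm
  · set t := ((B 0 - A 0) * (K 0 - A 0) + (B 1 - A 1) * (K 1 - A 1)) /
      ((B 0 - A 0) ^ 2 + (B 1 - A 1) ^ 2) with ht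
    have hmem : (!₂[A 0 + t * (B 0 - A 0), A 1 + t * (B 1 - A 1)] : Plane) ∈
        (line[ℝ, A, B] : Set Plane) := mem_line_iff_exists.2 ⟨t, by simp, by simp⟩
    refine (Metric.infDist_le_dist_of_mem hmem).trans (le_of_sq_le_sq ?_ (by positivity))
    rw [div_pow, sq_abs, hsq, dist_sq_plane]
    simp only [Matrix.cons_val_zero, Matrix.cons_val_one, ht, orient]
    apply le_of_eq
    field_simp
    ring
  · refine (Metric.le_infDist ⟨A, left_mem_affineSpan_pair ℝ A B⟩).2 fun X hX => ?_
    have hX' := (mem_line_iff_orient h).1 hX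
    rw [div_le_iff₀ hd]
    refine abs_le_of_sq_le_sq ?_ (by positivity)
    rw [mul_pow, hsq, dist_sq_plane]
    have : orient A B K = (B 0 - A 0) * (K 1 - X 1) - (B 1 - A 1) * (K 0 - X 0) := by
      simp only [orient] at hX' ⊢
      linear_combination hX'
    rw [this]
    -- Lagrange's identity: the squared determinant plus the squared inner product is the product of
    -- the squared lengths.
    nlinarith [sq_nonneg ((B 0 - A 0) * (K 0 - X 0) + (B 1 - A 1) * (K 1 - X 1))]

/-- A point off the line `AB` determines the pole of that line. -/
theorem eq_of_mem_polarLine {A B F Y Z : Plane} {r : ℝ} (h : orient A B F ≠ 0)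
    (hYA : A ∈ polarLine F r Y) (hYB : B ∈ polarLine F r Y)
    (hZA : A ∈ polarLine F r Z) (hZB : B ∈ polarLine F r Z) : Y = Z := by
  simp only [polarLine, Set.mem_ofPred_eq, inner_plane, PiLp.sub_apply] at hYA hYB hZA hZB
  simp only [orient] at h
  apply Plane.ext' <;> apply mul_left_cancel₀ h
  · linear_combination (B 1 - F 1) * hYA - (B 1 - F 1) * hZA - (A 1 - F 1) * hYB
      + (A 1 - F 1) * hZB
  · linear_combination -(B 0 - F 0) * hYA + (B 0 - F 0) * hZA + (A 0 - F 0) * hYB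
      - (A 0 - F 0) * hZB

theorem isPolarImage_iff_eq {N : ℕ} [NeZero N] {F : Plane} {r : ℝ} {P Q : Polygon Plane N}
    (hF : ∀ i, orient (P i) (P (i + 1)) F ≠ 0) (hQ : IsPolarImage F r P Q)
    (Q' : Polygon Plane N) : IsPolarImage F r P Q' ↔ Q' = Q := by
  refine ⟨fun h => ?_, fun h => h ▸ hQ⟩
  obtain ⟨v⟩ := Q
  obtain ⟨w⟩ := Q'
  congr 1
  funext i
  have hA : P i ∈ (sideline P i : Set Plane) := left_mem_affineSpan_pair ℝ _ _
  have hB : P (i + 1) ∈ (sideline P i : Set Plane) := right_mem_affineSpan_pair ℝ _ _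
  exact eq_of_mem_polarLine (hF i) (h i ▸ hA) (h i ▸ hB) (hQ i ▸ hA) (hQ i ▸ hB)

/-! ### From Poncelet polygons to rotation orbits. -/

/-- A chord of `ellipse a b` tangent to the ellipse shrunk by the factor `μ`. -/
theorem dot_of_isTangentTo {a b μ : ℝ} (ha : a ≠ 0) (hb : b ≠ 0) (hμ : 0 < μ) {A B : Plane}
    (hA : A ∈ ellipse a b) (hB : B ∈ ellipse a b) (hne : A ≠ B)
    (h : IsTangentTo line[ℝ, A, B] (ellipse (μ * a) (μ * b))) :
    A 0 / a * (B 0 / a) + A 1 / b * (B 1 / b) = 2 * μ ^ 2 - 1 := by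
  obtain ⟨X, ⟨hX, hXE⟩, huniq⟩ := h
  obtain ⟨t, h₀, h₁⟩ := mem_line_iff_exists.1 hX
  simp only [ellipse, Set.mem_ofPred_eq] at hA hB hXE huniq
  set x₀ := A 0 / a with hx₀
  set y₀ := A 1 / b with hy₀
  set x₁ := B 0 / a with hx₁
  set y₁ := B 1 / b with hy₁
  have eA0 : A 0 = a * x₀ := by rw [hx₀]; field_simp
  have eA1 : A 1 = b * y₀ := by rw [hy₀]; field_simp
  have eB0 : B 0 = a * x₁ := by rw [hx₁]; field_simp
  have eB1 : B 1 = b * y₁ := by rw [hy₁]; field_simp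
  have hA' : x₀ ^ 2 + y₀ ^ 2 = 1 := by rw [← hA, hx₀, hy₀]; ring
  have hB' : x₁ ^ 2 + y₁ ^ 2 = 1 := by rw [← hB, hx₁, hy₁]; ring
  have key : (x₀ + t * (x₁ - x₀)) ^ 2 + (y₀ + t * (y₁ - y₀)) ^ 2 = μ ^ 2 := by
    rw [h₀, h₁, eA0, eA1, eB0, eB1] at hXE
    field_simp at hXE
    linear_combination hXE
  -- Swapping `t` with `1 - t` reflects the chord in its midpoint and, after scaling, preserves
  -- distance to the centre. Uniqueness of the contact point therefore forces `t = 1 / 2`.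
  have hY := huniq !₂[A 0 + (1 - t) * (B 0 - A 0), A 1 + (1 - t) * (B 1 - A 1)]
    ⟨mem_line_iff_exists.2 ⟨1 - t, by simp, by simp⟩, by
      simp only [Matrix.cons_val_zero, Matrix.cons_val_one, eA0, eA1, eB0, eB1]
      field_simp
      linear_combination key + (1 - 2 * t) * (hB' - hA')⟩
  have hY0 : A 0 + (1 - t) * (B 0 - A 0) = X 0 := by rw [← hY]; simp
  have hY1 : A 1 + (1 - t) * (B 1 - A 1) = X 1 := by rw [← hY]; simp
  have hD := sub_sq_add_sub_sq_pos hne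
  have ht : 1 - 2 * t = 0 := by
    apply (mul_eq_zero.1 (?_ : (1 - 2 * t) * ((B 0 - A 0) ^ 2 + (B 1 - A 1) ^ 2) = 0)).resolve_right
      hD.ne'
    linear_combination (B 0 - A 0) * (hY0 + h₀) + (B 1 - A 1) * (hY1 + h₁)
  obtain rfl : t = 1 / 2 := by linarith
  linear_combination 2 * key - hA' / 2 - hB' / 2

/-- Twice the signed area of the triangle with vertices `(x i, y i)`, `(x j, y j)`, `(x k, y k)`. -/
def tripleDet {ι : Type*} (x y : ι → ℝ) (i j k : ι) : ℝ :=
  (x j - x i) * (y k - y i) - (y j - y i) * (x k - x i)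

/-- The points `(x i, y i)` of the unit circle are the vertices of a convex polygon, and each of
them is obtained from the previous one by the rotation with matrix entries `C` and `S`. -/
structure IsConvexRotationOrbit {N : ℕ} [NeZero N] (C S : ℝ) (x y : Fin N → ℝ) : Prop where
  unit : ∀ i, x i ^ 2 + y i ^ 2 = 1
  rot_x : ∀ i, x (i + 1) = C * x i - S * y i
  rot_y : ∀ i, y (i + 1) = S * x i + C * y i
  sq_add_sq : C ^ 2 + S ^ 2 = 1
  det_pos : ∀ i j, j ≠ i → j ≠ i + 1 → 0 < S * tripleDet x y i (i + 1) j

theorem Fin.add_one_add_one_ne {N : ℕ} [NeZero N] (hN : 3 ≤ N) (i : Fin N) :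
    i + 1 + 1 ≠ i ∧ i + 1 + 1 ≠ i + 1 := by
  obtain ⟨n, rfl⟩ := Nat.exists_eq_add_of_le' hN
  constructor
  · rw [add_assoc]
    simp [Fin.ext_iff, Fin.val_add, Nat.mod_eq_of_lt (show 2 < n + 3 by lia)]
  · simp

theorem Fin.forall_eq_of_add_one_eq {N : ℕ} [NeZero N] {α : Type*} {s : Fin N → α}
    (h : ∀ i, s (i + 1) = s i) (i : Fin N) : s i = s 0 := by
  have key : ∀ k : ℕ, s (Fin.ofNat N k) = s 0 := by
    intro k
    induction k with
    | zero => rfl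
    | succ k ih =>
      rw [← ih, ← h (Fin.ofNat N k)]
      congr 1
      simp [Fin.ext_iff, Fin.val_add]
  simpa using key i

namespace IsConvexRotationOrbit

variable {N : ℕ} [NeZero N] {C S : ℝ} {x y : Fin N → ℝ}

theorem sin_ne_zero (hN : 3 ≤ N) (h : IsConvexRotationOrbit C S x y) : S ≠ 0 := by
  rintro rfl
  have hi := Fin.add_one_add_one_ne hN 0
  simpa using h.det_pos 0 (0 + 1 + 1) hi.1 hi.2

theorem cos_lt_one (hN : 3 ≤ N) (h : IsConvexRotationOrbit C S x y) : C < 1 := by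
  have hS := pow_pos (abs_pos.2 (h.sin_ne_zero hN)) 2
  rw [sq_abs] at hS
  nlinarith [h.sq_add_sq]

/-- Rotating an orbit gives an orbit. -/
theorem rotate (h : IsConvexRotationOrbit C S x y) {p q : ℝ} (hpq : p ^ 2 + q ^ 2 = 1) :
    IsConvexRotationOrbit C S (fun i => p * x i - q * y i) (fun i => q * x i + p * y i) where
  unit i := by linear_combination (x i ^ 2 + y i ^ 2) * hpq + h.unit i
  rot_x i := by simp only [h.rot_x, h.rot_y]; ring
  rot_y i := by simp only [h.rot_x, h.rot_y]; ring
  sq_add_sq := h.sq_add_sq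
  det_pos i j hi hj := by
    convert h.det_pos i j hi hj using 2
    simp only [tripleDet]
    linear_combination ((x (i + 1) - x i) * (y j - y i) - (y (i + 1) - y i) * (x j - x i)) * hpq

end IsConvexRotationOrbit

theorem IsPonceletMember.exists_orbit {N : ℕ} [NeZero N] (hN : 3 ≤ N) {a b μ : ℝ} (ha : 0 < a)
    (hb : 0 < b) (hμ : 0 < μ) {P : Polygon Plane N}
    (h : IsPonceletMember (ellipse a b) (ellipse (μ * a) (μ * b)) P) :
    ∃ (S : ℝ) (x y : Fin N → ℝ), IsConvexRotationOrbit (2 * μ ^ 2 - 1) S x y ∧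
      ∀ i, P i 0 = a * x i ∧ P i 1 = b * y i := by
  set x : Fin N → ℝ := fun i => P i 0 / a with hx
  set y : Fin N → ℝ := fun i => P i 1 / b with hy
  have hP0 : ∀ i, P i 0 = a * x i := fun i => by simp only [hx]; field_simp
  have hP1 : ∀ i, P i 1 = b * y i := fun i => by simp only [hy]; field_simp
  have hunit : ∀ i, x i ^ 2 + y i ^ 2 = 1 := fun i => by
    have := h.inscribed i
    simpa only [ellipse, Set.mem_ofPred_eq, hx, hy, div_pow] using this
  have hor : ∀ i j k, orient (P i) (P j) (P k) = a * b * tripleDet x y i j k := fun i j k => by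
    simp only [orient, tripleDet, hP0, hP1]
    ring
  have hside : ∀ i j k : Fin N, j ≠ i → j ≠ i + 1 → k ≠ i → k ≠ i + 1 →
      0 < tripleDet x y i (i + 1) j * tripleDet x y i (i + 1) k := by
    intro i j k h₁ h₂ h₃ h₄
    have := h.convex i j k h₁ h₂ h₃ h₄
    rw [StrictlySameSide, hor, hor] at this
    refine pos_of_mul_pos_right (a := (a * b) ^ 2) ?_ (by positivity)
    linarith
  have hnext : ∀ i, tripleDet x y i (i + 1) (i + 1 + 1) ≠ 0 := by
    intro i
    have hi := Fin.add_one_add_one_ne hN i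
    have := hside i _ _ hi.1 hi.2 hi.1 hi.2
    intro h0
    simp [h0] at this
  have hne : ∀ i, P i ≠ P (i + 1) := by
    intro i hi
    apply hnext i
    have e0 : x (i + 1) = x i := by simp only [hx, ← hi]
    have e1 : y (i + 1) = y i := by simp only [hy, ← hi]
    simp [tripleDet, e0, e1]
  have hdot : ∀ i, x i * x (i + 1) + y i * y (i + 1) = 2 * μ ^ 2 - 1 := fun i =>
    dot_of_isTangentTo ha.ne' hb.ne' hμ (h.inscribed i) (h.inscribed (i + 1)) (hne i)
      (h.circumscribed i)
  set C := 2 * μ ^ 2 - 1 with hC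
  set s : Fin N → ℝ := fun i => x i * y (i + 1) - x (i + 1) * y i with hs
  have hrx : ∀ i, x (i + 1) = C * x i - s i * y i := fun i => by
    simp only [hs, ← hdot i]
    linear_combination -x (i + 1) * hunit i
  have hry : ∀ i, y (i + 1) = s i * x i + C * y i := fun i => by
    simp only [hs, ← hdot i]
    linear_combination -y (i + 1) * hunit i
  have hsq : ∀ i, C ^ 2 + s i ^ 2 = 1 := fun i => by
    simp only [hs, ← hdot i]
    linear_combination (x (i + 1) ^ 2 + y (i + 1) ^ 2) * hunit i + hunit (i + 1)
  -- All `s i` agree up to sign. A sign change would undo the last rotation and put vertex `i + 2`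
  -- back on vertex `i`.
  have hconst : ∀ i, s (i + 1) = s i := by
    intro i
    have : s (i + 1) ^ 2 = s i ^ 2 := by linear_combination hsq (i + 1) - hsq i
    refine (sq_eq_sq_iff_eq_or_eq_neg.1 this).resolve_right fun hneg => hnext i ?_
    have e0 : x (i + 1 + 1) = x i := by
      rw [hrx (i + 1), hneg, hrx i, hry i]
      linear_combination x i * hsq i
    have e1 : y (i + 1 + 1) = y i := by
      rw [hry (i + 1), hneg, hrx i, hry i]
      linear_combination y i * hsq i
    simp [tripleDet, e0, e1]
  have hs0 := Fin.forall_eq_of_add_one_eq hconst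
  refine ⟨s 0, x, y, ⟨hunit, fun i => hs0 i ▸ hrx i, fun i => hs0 i ▸ hry i, hsq 0, ?_⟩,
    fun i => ⟨hP0 i, hP1 i⟩⟩
  intro i j hj hj'
  have hi := Fin.add_one_add_one_ne hN i
  have h₁ := hside i j _ hj hj' hi.1 hi.2
  -- The vertex `i + 2` serves as reference: its sign is computed here, and convexity carries it
  -- over to every other `j`.
  have h₂ : 0 < s 0 * tripleDet x y i (i + 1) (i + 1 + 1) := by
    have e : s 0 * tripleDet x y i (i + 1) (i + 1 + 1) = s 0 ^ 2 * (2 * (1 - C)) := by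
      simp only [tripleDet, hrx (i + 1), hry (i + 1), hrx i, hry i, hs0]
      linear_combination s 0 ^ 2 * (2 * (1 - C)) * hunit i +
        s 0 ^ 2 * (x i ^ 2 + y i ^ 2) * hsq 0
    have hne0 : s 0 * tripleDet x y i (i + 1) (i + 1 + 1) ≠ 0 := by
      refine mul_ne_zero (fun h0 => hnext i ?_) (hnext i)
      have e0 := hrx i
      have e1 := hry i
      have e2 := hrx (i + 1)
      have e3 := hry (i + 1)
      rw [hs0, h0] at e0 e1 e2 e3
      simp only [tripleDet, e0, e1, e2, e3]
      ring
    have hle : C ≤ 1 := by nlinarith [hsq 0, sq_nonneg (s 0)]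
    refine lt_of_le_of_ne ?_ hne0.symm
    rw [e]
    have : 0 ≤ 1 - C := by linarith
    positivity
  refine pos_of_mul_pos_left (b := tripleDet x y i (i + 1) (i + 1 + 1) ^ 2) ?_ (sq_nonneg _)
  linarith [mul_pos h₁ h₂]

/-! ### The polar image about a focus. -/

/-- The poles, with respect to a circle centred at the focus `(m, 0)`, of the tangents to an
ellipse with semi-axes proportional to `a` and `b`. The circle `x ^ 2 + y ^ 2 = 1` parametrizes
the tangents, and `g` is the linear eccentricity with its sign. -/
noncomputable def focalPolar {N : ℕ} (a b g k m : ℝ) (x y : Fin N → ℝ) : Polygon Plane N :=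
  ⟨fun i => !₂[m + k * x i / (a - g * x i), k * (a / b) * y i / (a - g * x i)]⟩

section

variable {N : ℕ} {a b g k m : ℝ} {x y : Fin N → ℝ}

theorem focalPolar_zero (i : Fin N) :
    focalPolar a b g k m x y i 0 = m + k * x i / (a - g * x i) := by simp [focalPolar]

theorem focalPolar_one (i : Fin N) :
    focalPolar a b g k m x y i 1 = k * (a / b) * y i / (a - g * x i) := by simp [focalPolar]

theorem sub_mul_pos_of_sq_le_one {a b g t : ℝ} (ha : 0 < a) (hb : 0 < b)
    (hg : g ^ 2 = a ^ 2 - b ^ 2) (ht : t ^ 2 ≤ 1) : 0 < a - g * t := by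
  have : (g * t) ^ 2 < a ^ 2 := by nlinarith [sq_nonneg g, pow_pos hb 2]
  linarith [abs_lt_of_sq_lt_sq this ha.le, le_abs_self (g * t)]

/-- In homogeneous coordinates, relative to the focus, the map is linear with determinant `k ^ 2 * a
^ 2 / b`. Dehomogenizing divides by the three weights. -/
theorem orient_focalPolar (hb : b ≠ 0) {i j l : Fin N} (hi : a - g * x i ≠ 0)
    (hj : a - g * x j ≠ 0) (hl : a - g * x l ≠ 0) :
    orient (focalPolar a b g k m x y i) (focalPolar a b g k m x y j)
        (focalPolar a b g k m x y l) =
      k ^ 2 * a ^ 2 / b / ((a - g * x i) * (a - g * x j) * (a - g * x l)) *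
        tripleDet x y i j l := by
  simp only [orient, focalPolar_zero, focalPolar_one, tripleDet]
  generalize hu : a - g * x i = u at *
  generalize hv : a - g * x j = v at *
  generalize hw : a - g * x l = w at *
  field_simp
  subst hu hv hw
  ring

theorem orient_focalPolar_focus {i j : Fin N} :
    orient (focalPolar a b g k m x y i) (focalPolar a b g k m x y j) !₂[m, 0] =
      k ^ 2 * a / b / ((a - g * x i) * (a - g * x j)) * (x i * y j - x j * y i) := by
  simp only [orient, focalPolar_zero, focalPolar_one, Matrix.cons_val_zero, Matrix.cons_val_one]
  generalize a - g * x i = u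
  generalize a - g * x j = v
  ring

theorem dist_focalPolar_sq (hb : b ≠ 0) (hg : g ^ 2 = a ^ 2 - b ^ 2) {i j : Fin N}
    (hi : a - g * x i ≠ 0) (hj : a - g * x j ≠ 0) (hui : x i ^ 2 + y i ^ 2 = 1)
    (huj : x j ^ 2 + y j ^ 2 = 1) :
    dist (focalPolar a b g k m x y i) (focalPolar a b g k m x y j) ^ 2 =
      2 * k ^ 2 * a ^ 2 / b ^ 2 * (1 - (x i * x j + y i * y j)) /
        ((a - g * x i) * (a - g * x j)) := by
  rw [dist_sq_plane]
  simp only [focalPolar_zero, focalPolar_one]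
  generalize hu : a - g * x i = u at *
  generalize hv : a - g * x j = v at *
  field_simp
  subst hu hv
  linear_combination (k ^ 2 * a ^ 2 * (a - g * x j) ^ 2) * hui +
    (k ^ 2 * a ^ 2 * (a - g * x i) ^ 2) * huj + k ^ 2 * (x i * (a - g * x j) - x j * (a - g * x i)) ^ 2 * hg

/-- After clearing denominators this is the focal-distance identity `(a * x - g) ^ 2 + b ^ 2 * y ^ 2
= (a - g * x) ^ 2` on the unit circle. -/
theorem cospherical_focalPolar (ha : 0 < a) (hb : 0 < b) (hk : 0 < k)
    (hg : g ^ 2 = a ^ 2 - b ^ 2) (hu : ∀ i, x i ^ 2 + y i ^ 2 = 1) :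
    EuclideanGeometry.Cospherical (Set.range (focalPolar a b g k m x y).vertices) := by
  refine ⟨!₂[m + k * g / b ^ 2, 0], k * a / b ^ 2, ?_⟩
  rintro _ ⟨i, rfl⟩
  have hW := sub_mul_pos_of_sq_le_one (t := x i) ha hb hg (by nlinarith [hu i, sq_nonneg (y i)])
  rw [← sq_eq_sq₀ dist_nonneg (by positivity), dist_sq_plane, focalPolar_zero, focalPolar_one]
  simp only [Matrix.cons_val_zero, Matrix.cons_val_one]
  generalize hw : a - g * x i = w at *
  field_simp
  subst hw
  linear_combination k ^ 2 * a ^ 2 * b ^ 2 * hu i + k ^ 2 * (x i ^ 2 * b ^ 2 + (a - g * x i) ^ 2) * hg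

end

namespace IsConvexRotationOrbit

variable {N : ℕ} [NeZero N] {C S : ℝ} {x y : Fin N → ℝ} {a b g k m : ℝ}

theorem sub_mul_pos (h : IsConvexRotationOrbit C S x y) (ha : 0 < a) (hb : 0 < b)
    (hg : g ^ 2 = a ^ 2 - b ^ 2) (i : Fin N) : 0 < a - g * x i :=
  sub_mul_pos_of_sq_le_one ha hb hg (by nlinarith [h.unit i, sq_nonneg (y i)])

theorem cross (h : IsConvexRotationOrbit C S x y) (i : Fin N) :
    x i * y (i + 1) - x (i + 1) * y i = S := by
  rw [h.rot_x, h.rot_y]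
  linear_combination S * h.unit i

theorem dot (h : IsConvexRotationOrbit C S x y) (i : Fin N) :
    x i * x (i + 1) + y i * y (i + 1) = C := by
  rw [h.rot_x, h.rot_y]
  linear_combination C * h.unit i

theorem isConvexPolygon_focalPolar (h : IsConvexRotationOrbit C S x y) (ha : 0 < a) (hb : 0 < b)
    (hk : 0 < k) (hg : g ^ 2 = a ^ 2 - b ^ 2) : IsConvexPolygon (focalPolar a b g k m x y) := by
  intro i j l hj hj' hl hl'
  have hW := h.sub_mul_pos ha hb hg
  rw [StrictlySameSide, orient_focalPolar hb.ne' (hW _).ne' (hW _).ne' (hW _).ne',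
    orient_focalPolar hb.ne' (hW _).ne' (hW _).ne' (hW _).ne', mul_mul_mul_comm]
  have h₀ := hW i
  have h₁ := hW (i + 1)
  have h₂ := hW j
  have h₃ := hW l
  refine mul_pos (by positivity) ?_
  refine pos_of_mul_pos_right (a := S ^ 2) ?_ (sq_nonneg S)
  linarith [mul_pos (h.det_pos i j hj hj') (h.det_pos i l hl hl')]

theorem isHarmonicPolygon_focalPolar (h : IsConvexRotationOrbit C S x y) (hN : 3 ≤ N)
    (ha : 0 < a) (hb : 0 < b) (hk : 0 < k) (hg : g ^ 2 = a ^ 2 - b ^ 2) :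
    IsHarmonicPolygon (focalPolar a b g k m x y) where
  convex := h.isConvexPolygon_focalPolar ha hb hk hg
  cyclic := cospherical_focalPolar ha hb hk hg h.unit
  symmedian := by
    have hW := h.sub_mul_pos ha hb hg
    have hC : 0 < 1 - C := by linarith [h.cos_lt_one hN]
    -- The ratio of distance to sidelength is `|orient| / dist ^ 2`. The weights cancel in this
    -- quotient, which leaves the stated constant.
    refine ⟨!₂[m, 0], b * |S| / (2 * a * (1 - C)), fun i j hj hj' => ?_, fun i => ?_⟩
    · rw [StrictlySameSide, orient_focalPolar hb.ne' (hW _).ne' (hW _).ne' (hW _).ne',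
        orient_focalPolar_focus, mul_mul_mul_comm, h.cross]
      have h₀ := hW i
      have h₁ := hW (i + 1)
      have h₂ := hW j
      exact mul_pos (by positivity) (h.det_pos i j hj hj')
    · have h₀ := hW i
      have h₁ := hW (i + 1)
      have hd := dist_focalPolar_sq (k := k) (m := m) hb.ne' hg h₀.ne' h₁.ne' (h.unit i)
        (h.unit (i + 1))
      rw [h.dot] at hd
      have hpos : 0 < dist (focalPolar a b g k m x y i) (focalPolar a b g k m x y (i + 1)) := by
        refine lt_of_le_of_ne dist_nonneg fun h0 => ?_
        rw [← h0] at hd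
        have : 0 < 2 * k ^ 2 * a ^ 2 / b ^ 2 * (1 - C) /
          ((a - g * x i) * (a - g * x (i + 1))) := by positivity
        linarith
      rw [sideline, infDist_line (dist_pos.1 hpos),
        orient_focalPolar_focus, h.cross, div_eq_iff hpos.ne', mul_assoc,
        ← sq, hd, abs_mul, abs_of_pos (by positivity)]
      field_simp

theorem polygonArea_focalPolar (h : IsConvexRotationOrbit C S x y) (ha : 0 < a) (hb : 0 < b)
    (hg : g ^ 2 = a ^ 2 - b ^ 2) :
    polygonArea (focalPolar a b g k m x y) =
      k ^ 2 * a * |S| / (2 * b) * ∑ i, 1 / ((a - g * x i) * (a - g * x (i + 1))) := by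
  have hW := h.sub_mul_pos ha hb hg
  have hsum : ∑ i, (focalPolar a b g k m x y i 0 * focalPolar a b g k m x y (i + 1) 1 -
      focalPolar a b g k m x y (i + 1) 0 * focalPolar a b g k m x y i 1) =
      k ^ 2 * a / b * S * ∑ i, 1 / ((a - g * x i) * (a - g * x (i + 1))) := by
    -- The translation by `m` contributes only a telescoping cyclic sum.
    have hshift : ∑ i, m * focalPolar a b g k m x y (i + 1) 1 =
        ∑ i, m * focalPolar a b g k m x y i 1 :=
      Equiv.sum_comp (Equiv.addRight 1) fun i => m * focalPolar a b g k m x y i 1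
    rw [Finset.mul_sum, ← sub_eq_zero, ← sub_eq_zero.2 hshift, ← sub_eq_zero,
      ← Finset.sum_sub_distrib, ← Finset.sum_sub_distrib, ← Finset.sum_sub_distrib]
    refine Finset.sum_eq_zero fun i _ => ?_
    have h₀ := (hW i).ne'
    have h₁ := (hW (i + 1)).ne'
    rw [← h.cross i]
    simp only [focalPolar_zero, focalPolar_one]
    field_simp
    ring
  have hpos : 0 ≤ ∑ i, 1 / ((a - g * x i) * (a - g * x (i + 1))) :=
    Finset.sum_nonneg fun i _ => one_div_nonneg.2 (mul_pos (hW _) (hW _)).le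
  rw [polygonArea, hsum, abs_mul, abs_of_nonneg hpos, abs_mul, abs_of_nonneg (by positivity)]
  field_simp

end IsConvexRotationOrbit

/-- The polar image of a Poncelet polygon with respect to a circle centred at a focus. -/
theorem IsConvexRotationOrbit.isPolarImage_iff {N : ℕ} [NeZero N] (hN : 3 ≤ N)
    {a b g μ r S : ℝ} (ha : 0 < a) (hb : 0 < b) (hμ : 0 < μ) (hr : 0 < r)
    (hg : g ^ 2 = a ^ 2 - b ^ 2) {x y : Fin N → ℝ}
    (h : IsConvexRotationOrbit (2 * μ ^ 2 - 1) S x y) {P : Polygon Plane N}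
    (hP : ∀ i, P i 0 = a * x i ∧ P i 1 = b * y i) (Q : Polygon Plane N) :
    IsPolarImage !₂[μ * g, 0] r P Q ↔
      Q = focalPolar a b g (r ^ 2 / μ) (μ * g) (fun i => μ * x i - S / (2 * μ) * y i)
        (fun i => S / (2 * μ) * x i + μ * y i) := by
  have hS := h.sin_ne_zero hN
  -- If `2 * μ ^ 2 - 1` and `S` are the cosine and sine of an angle, `μ` and `S / (2 * μ)` are those
  -- of half of it.
  have hpq : μ ^ 2 + (S / (2 * μ)) ^ 2 = 1 := by
    field_simp
    linear_combination h.sq_add_sq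
  have h' := h.rotate hpq
  have hW := h'.sub_mul_pos ha hb hg
  set X : Fin N → ℝ := fun i => μ * x i - S / (2 * μ) * y i with hX
  set Y : Fin N → ℝ := fun i => S / (2 * μ) * x i + μ * y i with hY
  -- The sideline is the tangent `X i * Z 0 / a + Y i * Z 1 / b = μ` to the inner ellipse.
  have hor : ∀ i Z, orient (P i) (P (i + 1)) Z =
      S / μ * (a * b * μ - a * Y i * Z 1 - b * X i * Z 0) := by
    intro i Z
    have hq : S = 2 * μ * (S / (2 * μ)) := by field_simp
    have hμS : S / μ = 2 * (S / (2 * μ)) := by field_simp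
    have ex := h.rot_x i
    have ey := h.rot_y i
    rw [hq] at ex ey
    simp only [orient, hP, hX, hY, hμS]
    rw [ex, ey]
    generalize S / (2 * μ) = q at hpq ⊢
    linear_combination 2 * a * x i * (Z 1 - b * y i) * hpq - 2 * b * y i * (Z 0 - a * x i) * hpq
      + 2 * q * a * b * μ * h.unit i
  have hne : ∀ i, P i ≠ P (i + 1) := by
    intro i hi
    have h0 := orient_self_left (P i) (P (i + 1))
    have := hor i !₂[μ * g, 0]
    rw [← hi] at this
    simp only [orient, Matrix.cons_val_zero, Matrix.cons_val_one, sub_self, zero_mul] at this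
    have h2 := mul_ne_zero (div_ne_zero hS hμ.ne') (mul_pos (mul_pos hb hμ) (hW i)).ne'
    apply h2
    linear_combination -this
  apply isPolarImage_iff_eq
  · intro i
    rw [hor]
    simp only [Matrix.cons_val_zero, Matrix.cons_val_one]
    have h2 := mul_ne_zero (div_ne_zero hS hμ.ne') (mul_pos (mul_pos hb hμ) (hW i)).ne'
    convert h2 using 1
    ring
  · intro i
    ext Z
    have hWi : 0 < a - g * X i := hW i
    rw [sideline, SetLike.mem_coe, mem_line_iff_orient (hne i), hor, polarLine,
      Set.mem_ofPred_eq, inner_plane]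
    simp only [PiLp.sub_apply, focalPolar_zero, focalPolar_one, Matrix.cons_val_zero,
      Matrix.cons_val_one]
    have hlin : (Z 0 - μ * g) * (μ * g + r ^ 2 / μ * X i / (a - g * X i) - μ * g) +
        (Z 1 - 0) * (r ^ 2 / μ * (a / b) * Y i / (a - g * X i) - 0) - r ^ 2 =
        -(r ^ 2 / (μ * b * (a - g * X i))) * (a * b * μ - a * Y i * Z 1 - b * X i * Z 0) := by
      generalize hw : a - g * X i = w at *
      field_simp
      subst hw
      ring
    have hr2 : -(r ^ 2 / (μ * b * (a - g * X i))) ≠ 0 := neg_ne_zero.2 (by positivity)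
    rw [mul_eq_zero, or_iff_right (div_ne_zero hS hμ.ne'), ← sub_eq_zero, hlin, mul_eq_zero,
      or_iff_right hr2]

/-! ### Closure for `N = 3, 5` and the reciprocal sums. -/

namespace IsConvexRotationOrbit

section

variable {N : ℕ} [NeZero N] {C S : ℝ} {x y : Fin N → ℝ}

theorem rot_symm_x (h : IsConvexRotationOrbit C S x y) (i : Fin N) :
    x i = C * x (i + 1) + S * y (i + 1) := by
  rw [h.rot_x, h.rot_y]
  linear_combination -x i * h.sq_add_sq

theorem rot_symm_y (h : IsConvexRotationOrbit C S x y) (i : Fin N) :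
    y i = -S * x (i + 1) + C * y (i + 1) := by
  rw [h.rot_x, h.rot_y]
  linear_combination -y i * h.sq_add_sq

end

theorem cos_eq_neg_half {C S : ℝ} {x y : Fin 3 → ℝ} (h : IsConvexRotationOrbit C S x y) :
    C = -1 / 2 := by
  have hx1 : x 1 = C * x 0 - S * y 0 := h.rot_x 0
  have hy1 : y 1 = S * x 0 + C * y 0 := h.rot_y 0
  have hx2 : x 2 = C * x 1 - S * y 1 := h.rot_x 1
  have hy2 : y 2 = S * x 1 + C * y 1 := h.rot_y 1
  have hx2' : x 2 = C * x 0 + S * y 0 := h.rot_symm_x 2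
  have hy2' : y 2 = -S * x 0 + C * y 0 := h.rot_symm_y 2
  rw [hx1, hy1] at hx2 hy2
  rw [hx2'] at hx2
  rw [hy2'] at hy2
  -- Two steps forward equal one step back: `cos 2θ = cos θ`.
  have hC : (C - 1) * (2 * C + 1) = 0 := by
    linear_combination -x 0 * hx2 - y 0 * hy2 + h.sq_add_sq +
      (C - C ^ 2 + S ^ 2) * h.unit 0
  have := (mul_eq_zero.1 hC).resolve_left (by linarith [h.cos_lt_one le_rfl])
  linarith

theorem cos_eq_golden {C S : ℝ} {x y : Fin 5 → ℝ} (h : IsConvexRotationOrbit C S x y) :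
    C = (√5 - 1) / 4 := by
  have hx1 : x 1 = C * x 0 - S * y 0 := h.rot_x 0
  have hy1 : y 1 = S * x 0 + C * y 0 := h.rot_y 0
  have hx2 : x 2 = C * x 1 - S * y 1 := h.rot_x 1
  have hy2 : y 2 = S * x 1 + C * y 1 := h.rot_y 1
  have hx3 : x 3 = C * x 2 - S * y 2 := h.rot_x 2
  have hy3 : y 3 = S * x 2 + C * y 2 := h.rot_y 2
  have hx4' : x 4 = C * x 0 + S * y 0 := h.rot_symm_x 4
  have hy4' : y 4 = -S * x 0 + C * y 0 := h.rot_symm_y 4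
  have hx3' : x 3 = C * x 4 + S * y 4 := h.rot_symm_x 3
  have hy3' : y 3 = -S * x 4 + C * y 4 := h.rot_symm_y 3
  have hS2 : S ^ 2 = 1 - C ^ 2 := by linarith [h.sq_add_sq]
  have hdet : 0 < S * tripleDet x y 0 1 3 := h.det_pos 0 3 (by decide) (by decide)
  have hC1 := h.cos_lt_one (by norm_num)
  -- Three steps forward equal two steps back: `cos 3θ = cos 2θ`.
  have hC : (C - 1) * (4 * C ^ 2 + 2 * C - 1) = 0 := by
    have ex : C * x 2 - S * y 2 = C * x 4 + S * y 4 := by rw [← hx3, hx3']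
    have ey : S * x 2 + C * y 2 = -S * x 4 + C * y 4 := by rw [← hy3, hy3']
    rw [hx2, hy2, hx1, hy1, hx4', hy4'] at ex ey
    linear_combination x 0 * ex + y 0 * ey + (3 * C - 1) * hS2 -
      (C ^ 3 - 3 * C * S ^ 2 - C ^ 2 + S ^ 2) * h.unit 0
  have hC' := (mul_eq_zero.1 hC).resolve_left (by linarith)
  -- Convexity rules out the pentagram, whose cosine `(-√5 - 1) / 4` lies below `-1 / 2`.
  have hpos : 0 < 1 + 2 * C := by
    have e : S * tripleDet x y 0 1 3 = S ^ 2 * (2 * (1 - C)) * (1 + 2 * C) := by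
      rw [tripleDet, hx3', hy3', hx4', hy4', hx1, hy1]
      linear_combination (S ^ 2 * (1 + 2 * C) * (2 * (1 - C))) * h.unit 0 +
        (x 0 ^ 2 + y 0 ^ 2) * S ^ 2 * hS2
    rw [e] at hdet
    refine pos_of_mul_pos_right hdet ?_
    have : 0 < 1 - C := by linarith
    positivity
  have hsq : (4 * C + 1) ^ 2 = 5 := by linear_combination 4 * hC'
  have : √5 = 4 * C + 1 := by
    rw [← hsq, Real.sqrt_sq]
    nlinarith
  linarith

theorem one_div_sum_add_one_div_sum_three {a b g C S : ℝ} (ha : 0 < a) (hb : 0 < b)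
    (hg : g ^ 2 = a ^ 2 - b ^ 2) {x y : Fin 3 → ℝ} (h : IsConvexRotationOrbit C S x y) :
    1 / ∑ i, 1 / ((a - g * x i) * (a - g * x (i + 1))) +
      1 / ∑ i, 1 / ((a - (-g) * x i) * (a - (-g) * x (i + 1))) = (a ^ 2 + 3 * b ^ 2) / 6 := by
  have hC := h.cos_eq_neg_half
  have hS2 : S ^ 2 = 3 / 4 := by
    have := h.sq_add_sq
    rw [hC] at this
    linarith
  have hx1 : x 1 = C * x 0 - S * y 0 := h.rot_x 0
  have hx2 : x 2 = C * x 0 + S * y 0 := h.rot_symm_x 2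
  have hy : y 0 ^ 2 = 1 - x 0 ^ 2 := by linarith [h.unit 0]
  have hsum0 : x 0 + x 1 + x 2 = 0 := by rw [hx1, hx2, hC]; ring
  have hprod : x 1 * x 2 = x 0 ^ 2 - 3 / 4 := by
    rw [hx1, hx2, hC]
    linear_combination -y 0 ^ 2 * hS2 - 3 / 4 * hy
  have key : ∀ g' : ℝ, g' ^ 2 = a ^ 2 - b ^ 2 →
      1 / ∑ i, 1 / ((a - g' * x i) * (a - g' * x (i + 1))) =
        (a - g' * x 0) * (a - g' * x 1) * (a - g' * x 2) / (3 * a) := by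
    intro g' hg'
    have h0 := (h.sub_mul_pos ha hb hg' 0).ne'
    have h1 := (h.sub_mul_pos ha hb hg' 1).ne'
    have h2 := (h.sub_mul_pos ha hb hg' 2).ne'
    have : ∑ i, 1 / ((a - g' * x i) * (a - g' * x (i + 1))) =
        3 * a / ((a - g' * x 0) * (a - g' * x 1) * (a - g' * x 2)) := by
      rw [Fin.sum_univ_three]
      change 1 / ((a - g' * x 0) * (a - g' * x 1)) + 1 / ((a - g' * x 1) * (a - g' * x 2)) +
        1 / ((a - g' * x 2) * (a - g' * x 0)) = _
      have hs : (a - g' * x 0) + (a - g' * x 1) + (a - g' * x 2) = 3 * a := by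
        linear_combination -g' * hsum0
      rw [← hs]
      generalize a - g' * x 0 = u at *
      generalize a - g' * x 1 = v at *
      generalize a - g' * x 2 = w at *
      field_simp
      ring
    rw [this, one_div_div]
  rw [key g hg, key (-g) (by rw [neg_sq, hg])]
  field_simp
  -- Terms odd in `g` have cancelled between the two foci; only the pairwise symmetric function of
  -- the `x i` remains.
  linear_combination (12 * a * g ^ 2) * hprod + (12 * a * g ^ 2 * x 0) * hsum0 - 9 * a * hg

theorem one_div_sum_add_one_div_sum_five {a b g C S : ℝ} (ha : 0 < a) (hb : 0 < b)
    (hg : g ^ 2 = a ^ 2 - b ^ 2) {x y : Fin 5 → ℝ} (h : IsConvexRotationOrbit C S x y) :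
    1 / ∑ i, 1 / ((a - g * x i) * (a - g * x (i + 1))) +
      1 / ∑ i, 1 / ((a - (-g) * x i) * (a - (-g) * x (i + 1))) =
      (a ^ 4 + 10 * b ^ 2 * a ^ 2 + 5 * b ^ 4) /
        (5 * ((5 + √5) * a ^ 2 + (3 - √5) * b ^ 2)) := by
  have hs5 : √5 ^ 2 = 5 := Real.sq_sqrt (by norm_num)
  have hs3 : √5 < 3 := by nlinarith [Real.sqrt_nonneg 5]
  have hC : 4 * C ^ 2 = 1 - 2 * C := by
    rw [h.cos_eq_golden]
    linear_combination hs5 / 4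
  have hS2 : S ^ 2 = 1 - C ^ 2 := by linarith [h.sq_add_sq]
  have hy : y 0 ^ 2 = 1 - x 0 ^ 2 := by linarith [h.unit 0]
  have hx1 : x 1 = C * x 0 - S * y 0 := h.rot_x 0
  have hy1 : y 1 = S * x 0 + C * y 0 := h.rot_y 0
  have hx2 : x 2 = C * x 1 - S * y 1 := h.rot_x 1
  have hx4 : x 4 = C * x 0 + S * y 0 := h.rot_symm_x 4
  have hy4 : y 4 = -S * x 0 + C * y 0 := h.rot_symm_y 4
  have hx3 : x 3 = C * x 4 + S * y 4 := h.rot_symm_x 3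
  have hx2' : x 2 = -(1 / 2 + C) * x 0 - 2 * C * S * y 0 := by
    rw [hx2, hx1, hy1]
    linear_combination -x 0 * hS2 + x 0 * hC / 2
  have hx3' : x 3 = -(1 / 2 + C) * x 0 + 2 * C * S * y 0 := by
    rw [hx3, hx4, hy4]
    linear_combination -x 0 * hS2 + x 0 * hC / 2
  have hC2 : C ^ 2 = (1 - 2 * C) / 4 := by linarith
  have hsum14 : x 1 + x 4 = 2 * C * x 0 := by rw [hx1, hx4]; ring
  have hsum23 : x 2 + x 3 = -(1 + 2 * C) * x 0 := by rw [hx2', hx3']; ring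
  have hprod14 : x 1 * x 4 = x 0 ^ 2 - 3 / 4 - C / 2 := by
    rw [hx1, hx4]
    linear_combination -y 0 ^ 2 * hS2 - (1 - C ^ 2) * hy + hC2
  have hprod23 : x 2 * x 3 = x 0 ^ 2 - 1 / 2 + C / 2 := by
    rw [hx2', hx3']
    linear_combination -4 * C ^ 2 * y 0 ^ 2 * hS2 - 4 * C ^ 2 * (1 - C ^ 2) * hy +
      (x 0 ^ 2 - (2 - 4 * C ^ 2 + 2 * C) * (1 - x 0 ^ 2)) * hC2
  have hmix : x 1 * x 2 + x 3 * x 4 = 1 / 2 + 2 * C - (1 + 2 * C) * x 0 ^ 2 := by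
    rw [hx1, hx4, hx2', hx3']
    linear_combination 4 * C * y 0 ^ 2 * hS2 + 4 * C * (1 - C ^ 2) * hy +
      (-2 * x 0 ^ 2 + (2 - 4 * C) * (1 - x 0 ^ 2)) * hC2
  -- Pairing vertices 1, 4 and 2, 3, symmetric about vertex 0, eliminates `S` and `y 0`, leaving `C`
  -- and `x 0`.
  have key : ∀ g' : ℝ, g' ^ 2 = a ^ 2 - b ^ 2 →
      1 / ∑ i, 1 / ((a - g' * x i) * (a - g' * x (i + 1))) =
        (a - g' * x 0) * (a ^ 2 - a * g' * (2 * C * x 0) + g' ^ 2 * (x 0 ^ 2 - 3 / 4 - C / 2)) *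
          (a ^ 2 + a * g' * ((1 + 2 * C) * x 0) + g' ^ 2 * (x 0 ^ 2 - 1 / 2 + C / 2)) /
          (5 * a ^ 3 + 5 / 2 * a * g' ^ 2 * (C - 1 / 2)) := by
    intro g' hg'
    have h0 := (h.sub_mul_pos ha hb hg' 0).ne'
    have h1 := (h.sub_mul_pos ha hb hg' 1).ne'
    have h2 := (h.sub_mul_pos ha hb hg' 2).ne'
    have h3 := (h.sub_mul_pos ha hb hg' 3).ne'
    have h4 := (h.sub_mul_pos ha hb hg' 4).ne'
    have e14 : (a - g' * x 1) * (a - g' * x 4) =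
        a ^ 2 - a * g' * (2 * C * x 0) + g' ^ 2 * (x 0 ^ 2 - 3 / 4 - C / 2) := by
      rw [← hsum14, ← hprod14]
      ring
    have e23 : (a - g' * x 2) * (a - g' * x 3) =
        a ^ 2 + a * g' * ((1 + 2 * C) * x 0) + g' ^ 2 * (x 0 ^ 2 - 1 / 2 + C / 2) := by
      rw [← hprod23]
      linear_combination -a * g' * hsum23
    have emix : (a - g' * x 1) * (a - g' * x 2) + (a - g' * x 3) * (a - g' * x 4) =
        2 * a ^ 2 + a * g' * x 0 + g' ^ 2 * (1 / 2 + 2 * C - (1 + 2 * C) * x 0 ^ 2) := by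
      rw [← hmix]
      linear_combination -a * g' * (hsum14 + hsum23)
    -- Over the common denominator, the numerator is the cyclic sum of products of three consecutive
    -- weights; its dependence on `x 0` drops out.
    have hnum : 5 * a ^ 3 + 5 / 2 * a * g' ^ 2 * (C - 1 / 2) =
        (a - g' * x 0) * ((a - g' * x 1) * (a - g' * x 4)) +
        (a - g' * x 0) * ((a - g' * x 1) * (a - g' * x 2) + (a - g' * x 3) * (a - g' * x 4)) +
        (a - g' * x 2) * (a - g' * x 3) * ((a - g' * x 1) + (a - g' * x 4)) := by
      have e : (a - g' * x 1) + (a - g' * x 4) = 2 * a - 2 * C * x 0 * g' := by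
        linear_combination -g' * hsum14
      rw [e, e14, e23, emix]
      linear_combination (4 * a * g' ^ 2 * x 0 ^ 2 + g' ^ 3 * x 0) * hC2
    have : ∑ i, 1 / ((a - g' * x i) * (a - g' * x (i + 1))) =
        (5 * a ^ 3 + 5 / 2 * a * g' ^ 2 * (C - 1 / 2)) /
          ((a - g' * x 0) * ((a - g' * x 1) * (a - g' * x 4)) *
            ((a - g' * x 2) * (a - g' * x 3))) := by
      rw [Fin.sum_univ_five, hnum]
      change 1 / ((a - g' * x 0) * (a - g' * x 1)) + 1 / ((a - g' * x 1) * (a - g' * x 2)) +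
        1 / ((a - g' * x 2) * (a - g' * x 3)) + 1 / ((a - g' * x 3) * (a - g' * x 4)) +
        1 / ((a - g' * x 4) * (a - g' * x 0)) = _
      clear hnum emix e14 e23
      generalize a - g' * x 0 = u₀ at *
      generalize a - g' * x 1 = u₁ at *
      generalize a - g' * x 2 = u₂ at *
      generalize a - g' * x 3 = u₃ at *
      generalize a - g' * x 4 = u₄ at *
      field_simp
      ring
    rw [this, one_div_div, e14, e23]
  have hden : 5 * a ^ 3 + 5 / 2 * a * g ^ 2 * (C - 1 / 2) =
      5 * a / 8 * ((5 + √5) * a ^ 2 + (3 - √5) * b ^ 2) := by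
    rw [hg, h.cos_eq_golden]
    ring
  have hpos : 0 < (5 + √5) * a ^ 2 + (3 - √5) * b ^ 2 := by
    have : 0 < 3 - √5 := by linarith
    positivity
  rw [key g hg, key (-g) (by rw [neg_sq, hg]), neg_sq, ← add_div, hden,
    div_eq_div_iff (by positivity) (by positivity)]
  -- The part even in `g` is twice the homogenized `T₅ / 16`, namely `2a⁵ - (5/2)a³g² + (5/8)ag⁴`.
  have hnum : (a - g * x 0) * (a ^ 2 - a * g * (2 * C * x 0) + g ^ 2 * (x 0 ^ 2 - 3 / 4 - C / 2)) *
        (a ^ 2 + a * g * ((1 + 2 * C) * x 0) + g ^ 2 * (x 0 ^ 2 - 1 / 2 + C / 2)) +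
      (a - (-g) * x 0) *
        (a ^ 2 - a * (-g) * (2 * C * x 0) + g ^ 2 * (x 0 ^ 2 - 3 / 4 - C / 2)) *
        (a ^ 2 + a * (-g) * ((1 + 2 * C) * x 0) + g ^ 2 * (x 0 ^ 2 - 1 / 2 + C / 2)) =
      a * (a ^ 4 + 10 * b ^ 2 * a ^ 2 + 5 * b ^ 4) / 8 := by
    have e : a * (a ^ 4 + 10 * b ^ 2 * a ^ 2 + 5 * b ^ 4) / 8 =
        2 * a ^ 5 - 5 / 2 * a ^ 3 * g ^ 2 + 5 / 8 * a * (g ^ 2) ^ 2 := by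
      rw [hg]
      ring
    rw [e]
    linear_combination
      -((2 * a * g * x 0 + g ^ 2 / 2) ^ 2 * (a - g * x 0) +
        (-2 * a * g * x 0 + g ^ 2 / 2) ^ 2 * (a + g * x 0)) * hC2
  rw [hnum]
  ring

end IsConvexRotationOrbit

/-! ### Assembly for both foci. -/

/-- This isolates the only part depending on `N`, the value `T`. It is assumed for all orbits
because it is applied to the half-angle rotation of the given one. -/
theorem exists_harmonic_polar_images {N : ℕ} [NeZero N] (hN : 3 ≤ N) {a b μ r S : ℝ}
    (hb : 0 < b) (hab : b ≤ a) (hμ : 0 < μ) (hr : 0 < r) {x y : Fin N → ℝ}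
    (h : IsConvexRotationOrbit (2 * μ ^ 2 - 1) S x y) {P : Polygon Plane N}
    (hP : ∀ i, P i 0 = a * x i ∧ P i 1 = b * y i) {T : ℝ}
    (hT : ∀ X Y : Fin N → ℝ, IsConvexRotationOrbit (2 * μ ^ 2 - 1) S X Y →
      1 / ∑ i, 1 / ((a - √(a ^ 2 - b ^ 2) * X i) * (a - √(a ^ 2 - b ^ 2) * X (i + 1))) +
        1 / ∑ i, 1 / ((a - (-√(a ^ 2 - b ^ 2)) * X i) *
          (a - (-√(a ^ 2 - b ^ 2)) * X (i + 1))) = T) :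
    ∃ Q₁ Q₂ : Polygon Plane N,
      (∀ Q, IsPolarImage (leftFocus (μ * a) (μ * b)) r P Q ↔ Q = Q₁) ∧
      (∀ Q, IsPolarImage (rightFocus (μ * a) (μ * b)) r P Q ↔ Q = Q₂) ∧
      IsHarmonicPolygon Q₁ ∧ IsHarmonicPolygon Q₂ ∧
      1 / polygonArea Q₁ + 1 / polygonArea Q₂ = 2 * b * μ ^ 2 / (a * |S|) * T / r ^ 4 := by
  have ha : 0 < a := hb.trans_le hab
  have hS : 0 < |S| := abs_pos.2 (h.sin_ne_zero hN)
  have hpq : μ ^ 2 + (S / (2 * μ)) ^ 2 = 1 := by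
    field_simp
    linear_combination h.sq_add_sq
  have h' := h.rotate hpq
  have hT' := hT _ _ h'
  have hg : √(a ^ 2 - b ^ 2) ^ 2 = a ^ 2 - b ^ 2 :=
    Real.sq_sqrt (sub_nonneg.2 (pow_le_pow_left₀ hb.le hab 2))
  have hsqrt : √((μ * a) ^ 2 - (μ * b) ^ 2) = μ * √(a ^ 2 - b ^ 2) := by
    rw [show (μ * a) ^ 2 - (μ * b) ^ 2 = μ ^ 2 * (a ^ 2 - b ^ 2) by ring,
      Real.sqrt_mul (sq_nonneg μ), Real.sqrt_sq hμ.le]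
  have hl : leftFocus (μ * a) (μ * b) = !₂[μ * -√(a ^ 2 - b ^ 2), 0] := by
    rw [leftFocus, hsqrt, mul_neg]
  have hr' : rightFocus (μ * a) (μ * b) = !₂[μ * √(a ^ 2 - b ^ 2), 0] := by
    rw [rightFocus, hsqrt]
  have hgn : (-√(a ^ 2 - b ^ 2)) ^ 2 = a ^ 2 - b ^ 2 := by rw [neg_sq, hg]
  have hk : 0 < r ^ 2 / μ := by positivity
  rw [hl, hr']
  refine ⟨_, _, h.isPolarImage_iff hN ha hb hμ hr hgn hP, h.isPolarImage_iff hN ha hb hμ hr hg hP,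
    h'.isHarmonicPolygon_focalPolar hN ha hb hk hgn,
    h'.isHarmonicPolygon_focalPolar hN ha hb hk hg, ?_⟩
  rw [h'.polygonArea_focalPolar ha hb hg, h'.polygonArea_focalPolar ha hb hgn, ← hT']
  have key : ∀ u v : ℝ, 1 / ((r ^ 2 / μ) ^ 2 * a * |S| / (2 * b) * u) +
      1 / ((r ^ 2 / μ) ^ 2 * a * |S| / (2 * b) * v) =
        2 * b * μ ^ 2 / (a * |S|) * (1 / v + 1 / u) / r ^ 4 := by
    intro u v
    rw [← one_div_mul_one_div _ u, ← one_div_mul_one_div _ v]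
    field_simp
    ring
  exact key _ _

theorem mainTheorem9 (a b μ r : ℝ) (hb : 0 < b) (hab : b ≤ a) (hμ₀ : 0 < μ) (hμ₁ : μ < 1)
    (hr : 0 < r) :
    (∀ P : Polygon Plane 3, IsPonceletMember (ellipse a b) (ellipse (μ * a) (μ * b)) P →
      ∃ Q₁ Q₂ : Polygon Plane 3,
        (∀ Q, IsPolarImage (leftFocus (μ * a) (μ * b)) r P Q ↔ Q = Q₁) ∧
        (∀ Q, IsPolarImage (rightFocus (μ * a) (μ * b)) r P Q ↔ Q = Q₂) ∧
        IsHarmonicPolygon Q₁ ∧ IsHarmonicPolygon Q₂ ∧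
        1 / polygonArea Q₁ + 1 / polygonArea Q₂ =
          (Real.sqrt 3 / 18 * (b / a) * (a ^ 2 + 3 * b ^ 2)) / r ^ 4) ∧
    (∀ P : Polygon Plane 5, IsPonceletMember (ellipse a b) (ellipse (μ * a) (μ * b)) P →
      ∃ Q₁ Q₂ : Polygon Plane 5,
        (∀ Q, IsPolarImage (leftFocus (μ * a) (μ * b)) r P Q ↔ Q = Q₁) ∧
        (∀ Q, IsPolarImage (rightFocus (μ * a) (μ * b)) r P Q ↔ Q = Q₂) ∧
        IsHarmonicPolygon Q₁ ∧ IsHarmonicPolygon Q₂ ∧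
        1 / polygonArea Q₁ + 1 / polygonArea Q₂ =
          (b / (40 * Real.sin (2 * Real.pi / 5) * a) *
            ((a ^ 4 + 10 * b ^ 2 * a ^ 2 + 5 * b ^ 4) *
              (Real.sqrt 5 * (a ^ 2 + 3 * b ^ 2) + 5 * a ^ 2 + 7 * b ^ 2) /
              (5 * a ^ 4 + 10 * b ^ 2 * a ^ 2 + b ^ 4))) / r ^ 4) := by
  have ha : 0 < a := hb.trans_le hab
  have hg : √(a ^ 2 - b ^ 2) ^ 2 = a ^ 2 - b ^ 2 :=
    Real.sq_sqrt (sub_nonneg.2 (pow_le_pow_left₀ hb.le hab 2))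
  constructor
  · intro P hP
    obtain ⟨S, x, y, h, hxy⟩ := hP.exists_orbit le_rfl ha hb hμ₀
    have hC := h.cos_eq_neg_half
    have hμ2 : μ ^ 2 = 1 / 4 := by linarith
    have hS : |S| = √3 / 2 := by
      rw [← sq_eq_sq₀ (abs_nonneg S) (by positivity), sq_abs, div_pow,
        Real.sq_sqrt (by norm_num)]
      have := h.sq_add_sq
      rw [hC] at this
      linarith
    convert exists_harmonic_polar_images le_rfl hb hab hμ₀ hr h hxy
      (fun X Y hXY => hXY.one_div_sum_add_one_div_sum_three ha hb hg) using 9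
    rw [hμ2, hS]
    have h3 : √3 ^ 2 = 3 := Real.sq_sqrt (by norm_num)
    field_simp
    linear_combination 24 * h3
  · intro P hP
    obtain ⟨S, x, y, h, hxy⟩ := hP.exists_orbit (by norm_num) ha hb hμ₀
    have hC := h.cos_eq_golden
    have h5 : √5 ^ 2 = 5 := Real.sq_sqrt (by norm_num)
    have hs3 : √5 < 3 := by nlinarith [Real.sqrt_nonneg 5]
    have hμ2 : μ ^ 2 = (3 + √5) / 8 := by linarith
    have hsin : 0 < Real.sin (2 * Real.pi / 5) :=
      Real.sin_pos_of_pos_of_lt_pi (by positivity) (by linarith [Real.pi_pos])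
    have hcos : Real.cos (2 * Real.pi / 5) = (√5 - 1) / 4 := by
      rw [mul_div_assoc, Real.cos_two_mul, Real.cos_pi_div_five]
      linear_combination h5 / 8
    have hS : |S| = Real.sin (2 * Real.pi / 5) := by
      rw [← sq_eq_sq₀ (abs_nonneg S) hsin.le, sq_abs, Real.sin_sq, hcos, ← hC]
      linarith [h.sq_add_sq]
    convert exists_harmonic_polar_images (by norm_num) hb hab hμ₀ hr h hxy
      (fun X Y hXY => hXY.one_div_sum_add_one_div_sum_five ha hb hg) using 9
    rw [hμ2, hS]
    have h3 : 0 < 3 - √5 := by linarith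
    have hden : 0 < (5 + √5) * a ^ 2 + (3 - √5) * b ^ 2 := by positivity
    -- Over `ℚ(√5)` the quartic is a quarter of `(5 + √5)a² + (3 - √5)b²` times its conjugate, and
    -- the conjugate cancels against the numerator.
    have hE : (√5 * (a ^ 2 + 3 * b ^ 2) + 5 * a ^ 2 + 7 * b ^ 2) /
        (5 * a ^ 4 + 10 * b ^ 2 * a ^ 2 + b ^ 4) =
        2 * (3 + √5) / ((5 + √5) * a ^ 2 + (3 - √5) * b ^ 2) := by
      rw [div_eq_div_iff (by positivity) hden.ne']
      linear_combination (a ^ 4 + 2 * a ^ 2 * b ^ 2 - 3 * b ^ 4) * h5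
    rw [mul_div_assoc _ _ (5 * a ^ 4 + 10 * b ^ 2 * a ^ 2 + b ^ 4), hE]
    field_simp
    ring
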